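/- Let $G=(V,E)$ be a finite directed acyclic multigraph (channels of unit capacity, parallel channels allowed) with a single source node $s$ having no incoming channels and a set $T\not\ni s$ of sink nodes having no outgoing channels. For $t\in T$ let $C_t$ be the minimum cut capacity between $s$ and $t$, let $w$ be an integer (the information rate) with $1\le w\le C_t$ for all $t\in T$, put $\delta_t=C_t-w$, and let $E_t\subseteq E$ be the set of channels from which there is a path to $t$. Let $\mathcal F$ be a field. A linear network code over $\mathcal F$ of rate $w$ consists of local encoding coefficients $k_{d,e}\in\mathcal F$ for $e\in E$ and $d\in In(tail(e))$, where $In(s)=\{d_1',\dots,d_w'\}$ is a set of $w$ imaginary message channels. Its extended global encoding kernels are the vectors in $\mathcal F^{In(s)\cup E}$ given by $\tilde f_{d_i'}=1_{d_i'}$ and $\tilde f_e=\sum_{d\in In(tail(e))}k_{d,e}\tilde f_d+1_e$ for $e\in E$, where $1_d$ denotes the indicator vector of $d$; $\tilde F_t$ is the matrix with columns $\tilde f_e$, $e\in In(t)$. For an error pattern $\rho\subseteq E$ let $\Delta(t,\rho)$ be the set of all $(0,Z)\tilde F_t$ with $Z\in\mathcal F^E$ vanishing outside $\rho$, and let $\Phi(t)=\{(X,0)\tilde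 F_t: X\in\mathcal F^w\}$. Let $rank_t(\rho)$ be the least $|\rho'|$ over all $\rho'\subseteq E$ such that $\Delta(t,\rho)\subseteq\Delta(t,\rho')$ for every linear network code over $\mathcal F$ of rate $w$. A code is regular if $\dim\Phi(t)=w$ for all $t\in T$, its minimum distance at $t$ is $d_{\min}^{(t)}=\min\{rank_t(\rho):\dim(\Delta(t,\rho)\cap\Phi(t))>0\}$, and a network MDS code is a regular code with $d_{\min}^{(t)}=\delta_t+1$ for all $t\in T$. If $|\mathcal F|\ge\sum_{t\in T}\binom{|E_t|}{\delta_t}$, then there exists a network MDS code over $\mathcal F$. Moreover $$\sum_{t\in T}\binom{|E_t|}{\delta_t}\le\sum_{t\in T}\binom{|E|}{\delta_t},$$ and the inequality is strict whenever $|T|>1$ and $\delta_t>0$ for at least one $t\in T$. -/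

import Mathlib

/-- A single-source multicast communication network: a directed acyclic multigraph with node
type `V` and channel type `E` (parallel channels are allowed, every channel has unit capacity),
one source node, which has no incoming channel, and a set of sink nodes, which have no outgoing
channel. All nodes other than the source and the sinks are internal nodes. -/
structure CommNetwork (V E : Type*) where
  tail : E → V
  head : E → V
  source : V
  sinks : Finset V
  source_notMem_sinks : source ∉ sinks
  head_ne_source : ∀ e, head e ≠ source
  tail_notMem_sinks : ∀ e, tail e ∉ sinks
  acyclic : ∀ e, ¬ Relation.TransGen (fun d e => head d = tail e) e e

namespace CommNetwork

variable {V E : Type*} (N : CommNetwork V E)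

/-- The channel `d` directly precedes the channel `e`, that is, `d ∈ In(tail e)`. -/
def Adj (d e : E) : Prop := N.head d = N.tail e

instance [DecidableEq V] (d e : E) : Decidable (N.Adj d e) :=
  inferInstanceAs (Decidable (N.head d = N.tail e))

/-- On a finite acyclic network, recursion along the channels is legitimate. -/
theorem adj_wf [Finite E] : WellFounded N.Adj := by
  have h : WellFounded (Relation.TransGen N.Adj) := by
    have : Std.Irrefl (Relation.TransGen N.Adj) := ⟨N.acyclic⟩
    exact Finite.wellFounded_of_trans_of_irrefl _
  exact Subrelation.wf (fun hab => Relation.TransGen.single hab) h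

/-- `(e₁, …, eₘ)` with `m ≥ 1` is a path from the node `i` to the node `j`. -/
def IsPath (p : List E) (i j : V) : Prop :=
  p.IsChain N.Adj ∧ p.head?.map N.tail = some i ∧ p.getLast?.map N.head = some j

/-- `C` is a cut between `i` and `j`: removing its channels leaves no path from `i` to `j`. -/
def IsCut (C : Finset E) (i j : V) : Prop :=
  ∀ p : List E, N.IsPath p i j → ∃ e ∈ p, e ∈ C

/-- The minimum cut capacity between `i` and `j`. -/
noncomputable def minCut (i j : V) : ℕ :=
  sInf {n | ∃ C : Finset E, N.IsCut C i j ∧ C.card = n}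

/-- The redundancy `δ_t = C_t - w` of the sink `t` at information rate `w`
(used only when `w ≤ C_t`). -/
noncomputable def redundancy (w : ℕ) (t : V) : ℕ := N.minCut N.source t - w

/-- The set `E_t` of the channels from which there is a path to the node `t`. -/
def connective (t : V) : Set E :=
  {e | ∃ p : List E, N.IsPath p (N.tail e) t ∧ p.head? = some e}

/-- A linear network code over `F` of information rate `w`, given by its local encoding
coefficients: `srcCoeff j e` is the coefficient from the `j`-th imaginary message channel at the
source to the channel `e` (`0` unless `e ∈ Out(s)`), and `coeff d e` is the coefficient of the pair
of channels `(d, e)` (`0` unless `d ∈ In(tail e)`). -/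
structure LinearCode (w : ℕ) (F : Type*) [Field F] where
  srcCoeff : Fin w → E → F
  coeff : E → E → F
  srcCoeff_eq_zero : ∀ j e, N.tail e ≠ N.source → srcCoeff j e = 0
  coeff_eq_zero : ∀ d e, ¬ N.Adj d e → coeff d e = 0

namespace LinearCode

variable {N} [Fintype E] [DecidableEq V] [DecidableEq E] {w : ℕ} {F : Type*} [Field F]

/-- The extended global encoding kernel of the channel `e`, a vector indexed by `In(s) ∪ E`,
where `In(s)` consists of the `w` imaginary message channels. -/
noncomputable def extKernel (c : N.LinearCode w F) : E → (Fin w ⊕ E → F) :=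
  N.adj_wf.fix fun e f =>
    (∑ j : Fin w, c.srcCoeff j e • Pi.single (Sum.inl j) 1)
      + (∑ d : {d : E // N.Adj d e}, c.coeff d e • f d d.2)
      + Pi.single (Sum.inr e) 1

/-- The recursion `f_e = ∑_{d ∈ In(tail e)} k_{d,e} f_d + 1_e`, where `f_{d'} = 1_{d'}` for the
imaginary message channels `d'`. -/
theorem extKernel_eq (c : N.LinearCode w F) (e : E) :
    c.extKernel e =
      (∑ j : Fin w, c.srcCoeff j e • Pi.single (Sum.inl j) 1)
        + (∑ d : {d : E // N.Adj d e}, c.coeff d e • c.extKernel d)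
        + Pi.single (Sum.inr e) 1 := by
  unfold extKernel
  rw [WellFounded.fix_eq]

/-- The decoding matrix at the node `t`; its columns are the extended global encoding kernels of
the channels in `In(t)`. -/
noncomputable def decodingMatrix (c : N.LinearCode w F) (t : V) :
    Matrix (Fin w ⊕ E) {e : E // N.head e = t} F :=
  Matrix.of fun d e => c.extKernel e d

/-- The message space `Φ(t) = {(X, 0) F_t : X ∈ F^w}`. -/
noncomputable def messageSpace (c : N.LinearCode w F) (t : V) :
    Submodule F ({e : E // N.head e = t} → F) where
  carrier := {y | ∃ X : Fin w → F, y = Matrix.vecMul (Sum.elim X 0) (c.decodingMatrix t)}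
  zero_mem' := ⟨0, by simp⟩
  add_mem' := by
    rintro _ _ ⟨X, rfl⟩ ⟨Y, rfl⟩
    refine ⟨X + Y, ?_⟩
    rw [← Matrix.add_vecMul, ← Sum.elim_add_add, add_zero]
  smul_mem' := by
    rintro a _ ⟨X, rfl⟩
    refine ⟨a • X, ?_⟩
    rw [← Matrix.smul_vecMul]
    congr 1
    ext (i | i) <;> simp

/-- The error space `Δ(t, ρ)` of the error pattern `ρ`: all vectors `(0, Z) F_t` where `Z` matches
`ρ`, that is, vanishes outside `ρ`. -/
noncomputable def errorSpace (c : N.LinearCode w F) (t : V) (ρ : Finset E) :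
    Submodule F ({e : E // N.head e = t} → F) where
  carrier := {y | ∃ Z : E → F, (∀ e ∉ ρ, Z e = 0) ∧
    y = Matrix.vecMul (Sum.elim 0 Z) (c.decodingMatrix t)}
  zero_mem' := ⟨0, by simp, by simp⟩
  add_mem' := by
    rintro _ _ ⟨X, hX, rfl⟩ ⟨Y, hY, rfl⟩
    refine ⟨X + Y, fun e he => by simp [hX e he, hY e he], ?_⟩
    rw [← Matrix.add_vecMul, ← Sum.elim_add_add, add_zero]
  smul_mem' := by
    rintro a _ ⟨X, hX, rfl⟩
    refine ⟨a • X, fun e he => by simp [hX e he], ?_⟩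
    rw [← Matrix.smul_vecMul]
    congr 1
    ext (i | i) <;> simp

end LinearCode

section Distance

variable [Fintype E] [DecidableEq V] [DecidableEq E] (w : ℕ) (F : Type*) [Field F]

/-- `ρ₁` is dominated by `ρ₂` with respect to `t`: `Δ(t, ρ₁) ⊆ Δ(t, ρ₂)` for every linear network
code. -/
def Dominated (t : V) (ρ₁ ρ₂ : Finset E) : Prop :=
  ∀ c : N.LinearCode w F, c.errorSpace t ρ₁ ≤ c.errorSpace t ρ₂

/-- The rank of an error pattern with respect to `t`: the least size of an error pattern that
dominates it. -/
noncomputable def patternRank (t : V) (ρ : Finset E) : ℕ :=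
  sInf {n | ∃ ρ' : Finset E, N.Dominated w F t ρ ρ' ∧ ρ'.card = n}

variable {N w F}

/-- The code is regular: `dim Φ(t) = w` at every sink `t`. -/
def LinearCode.IsRegular (c : N.LinearCode w F) : Prop :=
  ∀ t ∈ N.sinks, Module.finrank F (c.messageSpace t) = w

/-- `d` is the minimum distance of the code at `t`: the minimum of the ranks of the error patterns
`ρ` with `dim (Δ(t, ρ) ∩ Φ(t)) > 0`. -/
def LinearCode.IsMinDist (c : N.LinearCode w F) (t : V) (d : ℕ) : Prop :=
  IsLeast {n | ∃ ρ : Finset E,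
    0 < Module.finrank F (c.errorSpace t ρ ⊓ c.messageSpace t : Submodule F _) ∧
      N.patternRank w F t ρ = n} d

/-- The code is a network MDS code: it is regular and its minimum distance at every sink `t`
equals `δ_t + 1`. -/
def LinearCode.IsMDS (c : N.LinearCode w F) : Prop :=
  c.IsRegular ∧ ∀ t ∈ N.sinks, c.IsMinDist t (N.redundancy w t + 1)

end Distance

end CommNetwork

/-! It suffices that for each sink `t`, an input with at most `δ_t` channel errors and zero output
at `t` has zero message (`LinearCode.Resists`). The message space then has dimension `w` and meets
no error space of a pattern of rank at most `δ_t`. Conversely, a minimum cut always yields a pattern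
of rank `δ_t + 1` whose error space meets it (`Resists.isMinDist`).

Fix `t` and `ρ ⊆ E_t` of size `δ_t`. Take as unknowns the message and the symbols on the channels;
symbols entering `t` are zero, and each channel of `E_t` outside `ρ` gives one error-free linear
equation. Hall's theorem and the min-cut bound select a set `R` of unknowns containing the message
and match it to equations that involve no other possibly nonzero unknown (`exists_isLinkage`). If
this square system is nonsingular, the message vanishes (`eq_zero_of_isLinkage`).

There are `∑ (|E_t| choose δ_t)` such systems, made nonsingular simultaneously by choosing the
coefficients channel by channel, upstream first (`exists_coeff_stageMap_injective`). At each channel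
every system forbids at most one hyperplane, and `|F|` proper hyperplanes do not cover the
coefficient space. -/

/-! ### Avoiding hyperplanes -/

theorem exists_forall_sum_mul_ne_zero {F X ι : Type*} [Field F] [Fintype X] (P : X → Prop)
    (φ : ι → X → F) (I : Finset ι) (hφ : ∀ i ∈ I, ∃ x, P x ∧ φ i x ≠ 0)
    (hI : (I.card : ℕ∞) ≤ ENat.card F) :
    ∃ κ : X → F, (∀ x, ¬ P x → κ x = 0) ∧ ∀ i ∈ I, ∑ x, κ x * φ i x ≠ 0 := by
  classical
  induction I using Finset.induction_on with
  | empty => exact ⟨0, by simp, by simp⟩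
  | insert i I hi ih =>
    rw [Finset.card_insert_of_notMem hi] at hI
    have hlt : (I.card : ℕ∞) < ENat.card F :=
      lt_of_lt_of_le (by exact_mod_cast Nat.lt_succ_self _) hI
    obtain ⟨κ, hκP, hκ⟩ := ih (fun j hj => hφ j (Finset.mem_insert_of_mem hj)) hlt.le
    by_cases h0 : ∑ x, κ x * φ i x = 0
    · obtain ⟨x₀, hx₀, hne⟩ := hφ i (Finset.mem_insert_self _ _)
      -- The new vector is `1_{x₀} + a κ`. Since `κ` vanishes under `φ i`, its value at `i` is `φ i
      -- x₀ ≠ 0` for every `a`; only the old indices exclude a value of `a`, one each. Hence `|F|`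
      -- may equal the number of functionals.
      obtain ⟨a, ha⟩ : ∃ a : F, a ∉ I.image fun j => -φ j x₀ / ∑ x, κ x * φ j x := by
        by_contra! hall
        have h1 : (Set.univ : Set F) ⊆
            ↑(I.image fun j => -φ j x₀ / ∑ x, κ x * φ j x) := fun a _ => hall a
        have h2 := Set.encard_le_encard h1
        rw [Set.encard_univ, Set.encard_coe_eq_coe_finsetCard] at h2
        exact absurd (h2.trans (by exact_mod_cast Finset.card_image_le)) (not_le.mpr hlt)
      have hsum : ∀ j, ∑ x, ((Pi.single x₀ 1 : X → F) x + a * κ x) * φ j x =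
          φ j x₀ + a * ∑ x, κ x * φ j x := by
        intro j
        simp [add_mul, Finset.sum_add_distrib, Finset.mul_sum, mul_assoc, Pi.single_apply]
      refine ⟨fun x => (Pi.single x₀ 1 : X → F) x + a * κ x, fun x hx => ?_, fun j hj => ?_⟩
      · have : x ≠ x₀ := by rintro rfl; exact hx hx₀
        simp [this, hκP x hx]
      · rw [hsum]
        rcases Finset.mem_insert.mp hj with rfl | hj
        · simpa [h0] using hne
        · intro h
          refine ha (Finset.mem_image.mpr ⟨j, hj, ?_⟩)
          rw [div_eq_iff (hκ j hj)]
          linear_combination -h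
    · refine ⟨κ, hκP, fun j hj => ?_⟩
      rcases Finset.mem_insert.mp hj with rfl | hj
      · exact h0
      · exact hκ j hj

/-! ### Greedy choice of the columns of an acyclic matrix -/

section Greedy

variable {M E F : Type*} [Fintype M] [Fintype E] [Field F]

open Classical in
/-- The equations imposed on a row vector by the matching `σ` of the rows `R` when the columns
in `D` have been chosen: those columns are `κ e - 1_e`, all others are unit vectors. -/
noncomputable def stageMap (κ : E → M ⊕ E → F) (R : Finset (M ⊕ E)) (σ : M ⊕ E → E)
    (D : Finset E) : (M ⊕ E → F) →ₗ[F] (M ⊕ E → F) :=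
  LinearMap.pi fun x =>
    if x ∈ R ∧ σ x ∈ D then
      (∑ y, κ (σ x) y • LinearMap.proj (R := F) (φ := fun _ : M ⊕ E => F) y)
        - LinearMap.proj (Sum.inr (σ x))
    else LinearMap.proj x

theorem stageMap_of_mem {κ : E → M ⊕ E → F} {R : Finset (M ⊕ E)} {σ : M ⊕ E → E}
    {D : Finset E} {x : M ⊕ E} (hx : x ∈ R) (hσ : σ x ∈ D) (v : M ⊕ E → F) :
    stageMap κ R σ D v x = ∑ y, κ (σ x) y * v y - v (Sum.inr (σ x)) := by
  simp only [stageMap, LinearMap.pi_apply, if_pos (And.intro hx hσ)]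
  simp

theorem stageMap_of_not {κ : E → M ⊕ E → F} {R : Finset (M ⊕ E)} {σ : M ⊕ E → E}
    {D : Finset E} {x : M ⊕ E} (h : ¬ (x ∈ R ∧ σ x ∈ D)) (v : M ⊕ E → F) :
    stageMap κ R σ D v x = v x := by
  simp [stageMap, LinearMap.pi_apply, if_neg h]

theorem stageMap_insert_of_ne [DecidableEq E] {κ : E → M ⊕ E → F} {R : Finset (M ⊕ E)}
    {σ : M ⊕ E → E} {D : Finset E} {e : E} {k : M ⊕ E → F} {x : M ⊕ E}
    (h : x ∈ R → σ x ≠ e) (v : M ⊕ E → F) :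
    stageMap (Function.update κ e k) R σ (insert e D) v x = stageMap κ R σ D v x := by
  by_cases hx : x ∈ R ∧ σ x ∈ D
  · rw [stageMap_of_mem hx.1 hx.2, stageMap_of_mem hx.1 (Finset.mem_insert_of_mem hx.2),
      Function.update_of_ne (h hx.1)]
  · rw [stageMap_of_not hx, stageMap_of_not]
    rintro ⟨h1, h2⟩
    exact hx ⟨h1, (Finset.mem_insert.mp h2).resolve_left (h h1)⟩

/-- Choosing one more column is subject to at most one nonzero linear functional. -/
theorem stageMap_insert_injective [DecidableEq E] {Pre : M ⊕ E → E → Prop}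
    (hirr : ∀ e, ¬ Pre (Sum.inr e) e) {κ : E → M ⊕ E → F}
    (hκ : ∀ e x, ¬ Pre x e → κ e x = 0) {R : Finset (M ⊕ E)} {σ : M ⊕ E → E}
    (hσ : Set.InjOn σ R) (hR : ∀ x ∈ R, x = Sum.inr (σ x) ∨ Pre x (σ x)) {D : Finset E}
    (hD : ∀ e ∈ D, ∀ d, Pre (Sum.inr d) e → d ∈ D) {e : E} (he : e ∉ D)
    (hinj : Function.Injective (stageMap κ R σ D)) :
    (∀ k : M ⊕ E → F, (∀ x, ¬ Pre x e → k x = 0) →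
      Function.Injective (stageMap (Function.update κ e k) R σ (insert e D))) ∨
    ∃ φ : M ⊕ E → F, (∃ x, Pre x e ∧ φ x ≠ 0) ∧
      ∀ k : M ⊕ E → F, (∀ x, ¬ Pre x e → k x = 0) → ∑ x, k x * φ x ≠ 0 →
        Function.Injective (stageMap (Function.update κ e k) R σ (insert e D)) := by
  classical
  by_cases hex : ∃ x ∈ R, σ x = e
  swap
  · left
    intro k _
    push Not at hex
    have : stageMap (Function.update κ e k) R σ (insert e D) = stageMap κ R σ D := by
      refine LinearMap.ext fun v => funext fun x => ?_
      exact stageMap_insert_of_ne (hex x) v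
    rwa [this]
  obtain ⟨x, hxR, hxe⟩ := hex
  have hxD : ¬ (x ∈ R ∧ σ x ∈ D) := fun h => he (hxe ▸ h.2)
  -- Only row `x` changes, so a vector killed by the new map is a multiple of `v₀`; injectivity
  -- reduces to the new row being nonzero at `v₀`.
  obtain ⟨v₀, hv₀⟩ := LinearMap.injective_iff_surjective.mp hinj (Pi.single x 1)
  have key : ∀ k : M ⊕ E → F, ∑ y, k y * v₀ y - v₀ (Sum.inr e) ≠ 0 →
      Function.Injective (stageMap (Function.update κ e k) R σ (insert e D)) := by
    intro k hs
    rw [injective_iff_map_eq_zero]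
    intro v hv
    have h1 : stageMap κ R σ D v = stageMap κ R σ D (v x • v₀) := by
      rw [map_smul, hv₀]
      ext y
      by_cases hyx : y = x
      · subst hyx
        simp [stageMap_of_not hxD]
      · have hy : y ∈ R → σ y ≠ e := fun hyR h => hyx (hσ hyR hxR (h.trans hxe.symm))
        rw [← stageMap_insert_of_ne (k := k) hy, hv]
        simp [hyx]
    have h2 : v = v x • v₀ := hinj h1
    have h3 := congrFun hv x
    rw [stageMap_of_mem hxR (by simp [hxe]), hxe, Function.update_self, h2] at h3
    have h4 : v x * (∑ y, k y * v₀ y - v₀ (Sum.inr e)) = 0 := by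
      rw [mul_sub, Finset.mul_sum]
      simpa [mul_left_comm] using h3
    rw [h2, (mul_eq_zero.mp h4).resolve_right hs, zero_smul]
  -- When channel `e` is matched to its own equation, `v₀ = 1_e` and the new row takes the value
  -- `-1` there, whatever `k` is.
  by_cases hx : x = Sum.inr e
  · left
    intro k hk
    apply key
    have : v₀ = Pi.single (Sum.inr e) 1 := by
      apply hinj
      rw [hv₀, hx]
      ext y
      by_cases hy : y ∈ R ∧ σ y ∈ D
      · rw [stageMap_of_mem hy.1 hy.2]
        have h1 : κ (σ y) (Sum.inr e) = 0 := hκ _ _ fun h => he (hD _ hy.2 _ h)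
        have h2 : σ y ≠ e := fun h => he (h ▸ hy.2)
        have h3 : y ≠ Sum.inr e := by
          rintro rfl
          exact h2 (by rw [← hx]; exact hxe)
        simp [Pi.single_apply, h1, h2, h3]
      · rw [stageMap_of_not hy]
    simp [this, Pi.single_apply, hk _ (hirr e)]
  · right
    -- As `D` is closed under predecessors, row `inr e` is still a unit row: its equation can lie
    -- neither in `D` nor at `e`, which is matched to `x`.
    have hve : v₀ (Sum.inr e) = 0 := by
      have h1 := congrFun hv₀ (Sum.inr e)
      rw [stageMap_of_not] at h1
      · simpa [Pi.single_apply, Ne.symm hx] using h1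
      · rintro ⟨h2, h3⟩
        rcases hR _ h2 with h | h
        · exact hx (hσ hxR h2 (hxe.trans (Sum.inr_injective h)))
        · exact he (hD _ h3 _ h)
    have hvx : v₀ x = 1 := by
      have h1 := congrFun hv₀ x
      rw [stageMap_of_not hxD] at h1
      simpa using h1
    refine ⟨v₀, ⟨x, ?_, by simp [hvx]⟩, fun k _ hs => key k (by simpa [hve] using hs)⟩
    have := hR x hxR
    rw [hxe] at this
    exact this.resolve_left hx

/-- If the number of matchings is at most `|F|`, the coefficients can be chosen so that every
matched square submatrix is nonsingular. -/
theorem exists_coeff_stageMap_injective {ι : Type*} {Pre : M ⊕ E → E → Prop}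
    (hwf : WellFounded fun d e => Pre (Sum.inr d) e) (I : Finset ι)
    (hI : (I.card : ℕ∞) ≤ ENat.card F) (R : ι → Finset (M ⊕ E)) (σ : ι → M ⊕ E → E)
    (hσ : ∀ i ∈ I, Set.InjOn (σ i) (R i))
    (hR : ∀ i ∈ I, ∀ x ∈ R i, x = Sum.inr (σ i x) ∨ Pre x (σ i x)) :
    ∃ κ : E → M ⊕ E → F, (∀ e x, ¬ Pre x e → κ e x = 0) ∧
      ∀ i ∈ I, Function.Injective (stageMap κ (R i) (σ i) Finset.univ) := by
  classical
  have hirr : ∀ e, ¬ Pre (Sum.inr e) e := fun e h => hwf.irrefl.irrefl e h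
  suffices h : ∀ n ≤ Fintype.card E, ∃ D : Finset E, D.card = n ∧
      (∀ e ∈ D, ∀ d, Pre (Sum.inr d) e → d ∈ D) ∧
      ∃ κ : E → M ⊕ E → F, (∀ e x, ¬ Pre x e → κ e x = 0) ∧
        ∀ i ∈ I, Function.Injective (stageMap κ (R i) (σ i) D) by
    obtain ⟨D, hDc, -, h⟩ := h _ le_rfl
    rwa [Finset.card_eq_iff_eq_univ D |>.mp hDc] at h
  intro n
  induction n with
  | zero =>
    refine fun _ => ⟨∅, rfl, by simp, 0, by simp, fun i _ v v' h => ?_⟩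
    ext x
    have := congrFun h x
    rwa [stageMap_of_not (by simp), stageMap_of_not (by simp)] at this
  | succ n ih =>
    intro hn
    obtain ⟨D, hDc, hD, κ, hκ, hinj⟩ := ih (by omega)
    have hne : {e | e ∉ D}.Nonempty := by
      by_contra h
      rw [Set.not_nonempty_iff_eq_empty, Set.eq_empty_iff_forall_notMem] at h
      have : D = Finset.univ := Finset.eq_univ_iff_forall.mpr fun e => by simpa using h e
      rw [this, Finset.card_univ] at hDc
      omega
    obtain ⟨e, he, hmin⟩ : ∃ e, e ∉ D ∧ ∀ d, Pre (Sum.inr d) e → d ∈ D :=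
      ⟨hwf.min _ hne, hwf.min_mem _ hne, fun d hd => by
        by_contra h
        exact hwf.not_lt_min _ h hd⟩
    have hstep := fun i hi => stageMap_insert_injective hirr hκ (hσ i hi) (hR i hi) hD he
      (hinj i hi)
    set free : ι → Prop := fun i => ∀ k : M ⊕ E → F, (∀ x, ¬ Pre x e → k x = 0) →
      Function.Injective (stageMap (Function.update κ e k) (R i) (σ i) (insert e D)) with hfree
    have hφ : ∀ i, ∃ φ : M ⊕ E → F, i ∈ I.filter (fun i => ¬ free i) →
        (∃ x, Pre x e ∧ φ x ≠ 0) ∧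
        ∀ k : M ⊕ E → F, (∀ x, ¬ Pre x e → k x = 0) → ∑ x, k x * φ x ≠ 0 →
        Function.Injective (stageMap (Function.update κ e k) (R i) (σ i) (insert e D)) := by
      intro i
      by_cases hi : i ∈ I.filter (fun i => ¬ free i)
      · obtain ⟨h1, h2⟩ := Finset.mem_filter.mp hi
        obtain ⟨φ, hφ⟩ := (hstep i h1).resolve_left h2
        exact ⟨φ, fun _ => hφ⟩
      · exact ⟨0, fun h => absurd h hi⟩
    choose φ hφ using hφ
    obtain ⟨k, hkP, hk⟩ := exists_forall_sum_mul_ne_zero (fun x => Pre x e) φ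
      (I.filter fun i => ¬ free i) (fun i hi => (hφ i hi).1)
      (le_trans (by exact_mod_cast Finset.card_filter_le _ _) hI)
    refine ⟨insert e D, by rw [Finset.card_insert_of_notMem he, hDc], ?_,
      Function.update κ e k, ?_, fun i hi => ?_⟩
    · intro e' he' d hd
      rcases Finset.mem_insert.mp he' with rfl | he'
      · exact Finset.mem_insert_of_mem (hmin d hd)
      · exact Finset.mem_insert_of_mem (hD e' he' d hd)
    · intro e' x hx
      by_cases h : e' = e
      · subst h
        simpa using hkP x hx
      · simpa [h] using hκ e' x hx
    · by_cases hf : free i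
      · exact hf k hkP
      · have hi' : i ∈ I.filter fun i => ¬ free i := Finset.mem_filter.mpr ⟨hi, hf⟩
        exact (hφ i hi').2 k hkP (hk i hi')

end Greedy

/-! ### Matchings outside a set of maximal deficiency -/

/-- Let `S₀ ⊆ B` maximize the deficiency `|S| - |N(S)|`, and delete it with its neighbours. Hall's
condition survives: for sets inside `B` by maximality, for sets meeting `A` by the surplus assumed
in `h`. -/
theorem exists_matching_sdiff {α β : Type*} [DecidableEq α] [DecidableEq β]
    (nb : α → Finset β) (A B : Finset α) (hA : A.Nonempty) (hAB : Disjoint A B)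
    (h : ∀ S ⊆ A ∪ B, ¬ Disjoint S A → (S ∩ B).card + A.card ≤ (S.biUnion nb).card) :
    ∃ S₀ ⊆ B, ∃ σ : α → β, Set.InjOn σ ((A ∪ B) \ S₀ : Finset α) ∧
      ∀ x ∈ (A ∪ B) \ S₀, σ x ∈ nb x \ S₀.biUnion nb := by
  obtain ⟨S₀, hS₀, hmax⟩ := B.powerset.exists_max_image
    (fun S => (S.card : ℤ) - (S.biUnion nb).card) ⟨∅, by simp⟩
  rw [Finset.mem_powerset] at hS₀
  refine ⟨S₀, hS₀, ?_⟩
  have hall : ∀ S ⊆ (A ∪ B) \ S₀, S.card + (S₀.biUnion nb).card ≤ ((S ∪ S₀).biUnion nb).card := by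
    intro S hS
    have hSd : Disjoint S S₀ := Finset.disjoint_of_subset_left hS Finset.sdiff_disjoint
    by_cases hA : Disjoint S A
    · have hSB : S ⊆ B := fun x hx =>
        (Finset.mem_union.mp (Finset.mem_sdiff.mp (hS hx)).1).resolve_left
          (Finset.disjoint_left.mp hA hx)
      have h1 := hmax (S ∪ S₀) (Finset.mem_powerset.mpr (Finset.union_subset hSB hS₀))
      rw [Finset.card_union_of_disjoint hSd] at h1
      push_cast at h1
      omega
    · have h1 := h (S ∪ S₀)
        (Finset.union_subset (hS.trans Finset.sdiff_subset)
          (hS₀.trans Finset.subset_union_right))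
        (fun hd => hA (Finset.disjoint_of_subset_left Finset.subset_union_left hd))
      -- Comparison with `∅` shows that `S₀` has at least as many elements as neighbours.
      have h2 := hmax ∅ (by simp)
      have h3 : (S ∪ S₀) ∩ B = (S ∩ B) ∪ S₀ := by
        rw [Finset.union_inter_distrib_right, Finset.inter_eq_left.mpr hS₀]
      rw [h3, Finset.card_union_of_disjoint
        (Finset.disjoint_of_subset_left Finset.inter_subset_left hSd)] at h1
      have h4 : S.card ≤ A.card + (S ∩ B).card := by
        refine le_trans (Finset.card_le_card ?_) (Finset.card_union_le A (S ∩ B))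
        intro x hx
        rcases Finset.mem_union.mp (Finset.mem_sdiff.mp (hS hx)).1 with hx' | hx'
        · exact Finset.mem_union_left _ hx'
        · exact Finset.mem_union_right _ (Finset.mem_inter.mpr ⟨hx, hx'⟩)
      simp only [Finset.biUnion_empty, Finset.card_empty] at h2
      omega
  obtain ⟨f, hf, hfm⟩ := (Finset.all_card_le_biUnion_card_iff_exists_injective
    (fun x : {x // x ∈ (A ∪ B) \ S₀} => nb x \ S₀.biUnion nb)).mp (by
      intro s
      have h1 := hall (s.map (Function.Embedding.subtype _)) (by
        intro x hx
        obtain ⟨y, -, rfl⟩ := Finset.mem_map.mp hx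
        exact y.2)
      rw [Finset.card_map] at h1
      have h2 : ((s.map (Function.Embedding.subtype _)) ∪ S₀).biUnion nb ⊆
          (s.biUnion fun x => nb x \ S₀.biUnion nb) ∪ S₀.biUnion nb := by
        intro b hb
        by_cases hb' : b ∈ S₀.biUnion nb
        · exact Finset.mem_union_right _ hb'
        · obtain ⟨x, hx, hbx⟩ := Finset.mem_biUnion.mp hb
          rcases Finset.mem_union.mp hx with hx | hx
          · obtain ⟨y, hy, rfl⟩ := Finset.mem_map.mp hx
            exact Finset.mem_union_left _
              (Finset.mem_biUnion.mpr ⟨y, hy, Finset.mem_sdiff.mpr ⟨hbx, hb'⟩⟩)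
          · exact absurd (Finset.mem_biUnion.mpr ⟨x, hx, hbx⟩) hb'
      have h3 := (Finset.card_le_card h2).trans (Finset.card_union_le _ _)
      omega)
  obtain ⟨x₀, hx₀⟩ : ((A ∪ B) \ S₀).Nonempty := by
    obtain ⟨a, ha⟩ := hA
    exact ⟨a, Finset.mem_sdiff.mpr ⟨Finset.mem_union_left _ ha,
      fun h => Finset.disjoint_left.mp hAB ha (hS₀ h)⟩⟩
  refine ⟨fun x => if hx : x ∈ (A ∪ B) \ S₀ then f ⟨x, hx⟩ else f ⟨x₀, hx₀⟩, ?_, ?_⟩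
  · intro x hx y hy hxy
    rw [Finset.mem_coe] at hx hy
    simp only [hx, hy, dif_pos] at hxy
    exact congrArg Subtype.val (hf hxy)
  · intro x hx
    simp only [hx, dif_pos]
    exact hfm ⟨x, hx⟩

namespace CommNetwork

variable {V E : Type*} {N : CommNetwork V E}

/-! ### Paths and cuts -/

theorem not_isPath_nil (i j : V) : ¬ N.IsPath [] i j := by
  rintro ⟨-, h, -⟩
  simp at h

theorem isPath_singleton (e : E) : N.IsPath [e] (N.tail e) (N.head e) :=
  ⟨List.isChain_singleton e, rfl, rfl⟩

theorem isPath_cons_iff {e : E} {p : List E} {i j : V} :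
    N.IsPath (e :: p) i j ↔
      N.tail e = i ∧ ((p = [] ∧ N.head e = j) ∨ N.IsPath p (N.head e) j) := by
  cases p with
  | nil =>
    simp only [IsPath, List.head?_nil, List.getLast?_nil]
    simp
  | cons d p =>
    simp only [IsPath, List.isChain_cons_cons, Adj, List.head?_cons, List.getLast?_cons_cons,
      Option.map_some, Option.some.injEq, reduceCtorEq, false_and, false_or]
    constructor
    · rintro ⟨⟨h1, h2⟩, h3, h4⟩
      exact ⟨h3, h2, h1.symm, h4⟩
    · rintro ⟨h3, h2, h1, h4⟩
      exact ⟨⟨h1.symm, h2⟩, h3, h4⟩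

theorem mem_connective_of_isPath {e : E} {p : List E} {i t : V} (h : N.IsPath (e :: p) i t) :
    e ∈ N.connective t := by
  refine ⟨e :: p, ?_, rfl⟩
  have := (isPath_cons_iff.mp h).1
  rwa [this]

theorem mem_connective_of_adj {d e : E} {t : V} (hde : N.Adj d e) (he : e ∈ N.connective t) :
    d ∈ N.connective t := by
  obtain ⟨p, hp, -⟩ := he
  refine mem_connective_of_isPath (p := p) (isPath_cons_iff.mpr ⟨rfl, Or.inr ?_⟩)
  rwa [show N.head d = N.tail e from hde]

/-- The witness is the first channel of the path outside `R`, which exists because the last channel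
enters `t`; all channels before it lie in `R` and pass `P` on. -/
theorem exists_mem_of_isPath {P : E → Prop} {R : Set E} {t : V} (hR : ∀ e ∈ R, N.head e ≠ t)
    (p : List E) (i : V) (hp : N.IsPath p i t)
    (hi : ∀ e, N.tail e = i → P e) (hP : ∀ d e, d ∈ R → N.Adj d e → P e) :
    ∃ e ∈ p, e ∈ N.connective t ∧ e ∉ R ∧ P e := by
  induction p generalizing i with
  | nil => exact absurd hp (not_isPath_nil _ _)
  | cons e p ih =>
    obtain ⟨he, h⟩ := isPath_cons_iff.mp hp
    by_cases heR : e ∈ R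
    · rcases h with ⟨-, h⟩ | h
      · exact absurd h (hR e heR)
      · obtain ⟨e', he', h'⟩ := ih _ h fun e' he' => hP e e' heR he'.symm
        exact ⟨e', List.mem_cons_of_mem _ he', h'⟩
    · exact ⟨e, List.mem_cons_self, mem_connective_of_isPath hp, heR, hi e he⟩

theorem notMem_connective_of_head_mem_sinks {e : E} {t : V} (he : N.head e ∈ N.sinks)
    (hne : N.head e ≠ t) : e ∉ N.connective t := by
  rintro ⟨p, hp, hpe⟩
  cases p with
  | nil => simp at hpe
  | cons d p =>
    obtain rfl : d = e := by simpa using hpe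
    rcases (isPath_cons_iff.mp hp).2 with ⟨-, h⟩ | h
    · exact hne h
    · cases p with
      | nil => exact not_isPath_nil _ _ h
      | cons e' p => exact N.tail_notMem_sinks e' ((isPath_cons_iff.mp h).1 ▸ he)

theorem minCut_le {C : Finset E} {i j : V} (hC : N.IsCut C i j) : N.minCut i j ≤ C.card :=
  Nat.sInf_le ⟨C, hC, rfl⟩

theorem exists_isCut_card_eq_minCut [Fintype E] (i j : V) :
    ∃ C : Finset E, N.IsCut C i j ∧ C.card = N.minCut i j := by
  refine Nat.sInf_mem (s := {n | ∃ C : Finset E, N.IsCut C i j ∧ C.card = n})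
    ⟨_, Finset.univ, fun p hp => ?_, rfl⟩
  cases p with
  | nil => exact absurd hp (not_isPath_nil _ _)
  | cons e p => exact ⟨e, List.mem_cons_self, Finset.mem_univ _⟩

/-- Every set `R` of channels avoiding `In(t)` has at least `C_t` outgoing channels, counting also
the outgoing channels of the source. -/
theorem minCut_le_card_boundary [Fintype E] {R C : Finset E} {t : V} (hR : ∀ e ∈ R, N.head e ≠ t)
    (hC : ∀ e ∈ N.connective t, e ∉ R →
      (N.tail e = N.source ∨ ∃ d ∈ R, N.Adj d e) → e ∈ C) :
    N.minCut N.source t ≤ C.card := by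
  refine minCut_le fun p hp => ?_
  obtain ⟨e, hep, h1, h2, h3⟩ := exists_mem_of_isPath (R := ↑R)
    (P := fun e => N.tail e = N.source ∨ ∃ d ∈ R, N.Adj d e) hR p _ hp
    (fun e he => Or.inl he) (fun d e hd hde => Or.inr ⟨d, hd, hde⟩)
  exact ⟨e, hep, hC e h1 h2 h3⟩

theorem minCut_le_ncard_connective [Fintype E] (t : V) :
    N.minCut N.source t ≤ (N.connective t).ncard := by
  classical
  rw [Set.ncard_eq_toFinset_card' (N.connective t)]
  exact minCut_le_card_boundary (R := ∅) (by simp) fun e he _ _ => by simpa using he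

theorem exists_head_eq [Fintype E] {t : V} (h : 0 < N.minCut N.source t) : ∃ e, N.head e = t := by
  by_contra! hne
  have := minCut_le_card_boundary (N := N) (R := Finset.univ) (C := ∅) (t := t)
    (fun e _ => hne e) (by simp)
  simp at this
  omega

/-! ### Matchings for the pairs of a sink and an error pattern -/

/-- The channel or imaginary message channel `x` belongs to `In(tail e)`. -/
def Precedes (N : CommNetwork V E) {w : ℕ} : Fin w ⊕ E → E → Prop :=
  Sum.elim (fun _ e => N.tail e = N.source) N.Adj

/-- The rows `R` and their matching `σ` express that any code for which the matched square
submatrix is nonsingular recovers the message at `t` from errors in `ρ`. -/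
structure IsLinkage (N : CommNetwork V E) {w : ℕ} (t : V) (ρ : Finset E) (R : Finset (Fin w ⊕ E))
    (σ : Fin w ⊕ E → E) : Prop where
  injOn : Set.InjOn σ R
  precedes : ∀ x ∈ R, x = Sum.inr (σ x) ∨ N.Precedes x (σ x)
  inl_mem : ∀ j, Sum.inl j ∈ R
  head_ne : ∀ d, Sum.inr d ∈ R → N.head d ≠ t
  mem_connective : ∀ x ∈ R, σ x ∈ N.connective t
  notMem : ∀ x ∈ R, σ x ∉ ρ
  inr_mem : ∀ x ∈ R, ∀ d, N.head d ≠ t → (d = σ x ∨ N.Adj d (σ x)) → Sum.inr d ∈ R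

/-- Unknowns are joined to the equations outside `ρ` in which they occur. A set of unknowns
containing a message symbol and the channels `R` touches the equations of `R` and of its boundary,
which has at least `C_t` channels; removing `ρ` leaves at least `|R| + w`. -/
theorem exists_isLinkage [Fintype E] {w : ℕ} (hw : 1 ≤ w) {t : V} {ρ : Finset E}
    (hρ : w + ρ.card ≤ N.minCut N.source t) :
    ∃ (R : Finset (Fin w ⊕ E)) (σ : Fin w ⊕ E → E), N.IsLinkage t ρ R σ := by
  classical
  set A : Finset (Fin w ⊕ E) := Finset.univ.map Function.Embedding.inl with hA
  set B : Finset (Fin w ⊕ E) :=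
    (Finset.univ.filter fun d => d ∈ N.connective t ∧ N.head d ≠ t).map
      Function.Embedding.inr with hB
  have hmemA : ∀ j, Sum.inl j ∈ A := fun j => by simp [hA]
  have hmemA' : ∀ d, Sum.inr d ∉ A := fun d => by simp [hA]
  have hmemB : ∀ d, Sum.inr d ∈ B ↔ d ∈ N.connective t ∧ N.head d ≠ t := fun d => by simp [hB]
  have hmemB' : ∀ j, Sum.inl j ∉ B := fun d => by simp [hB]
  set nb : Fin w ⊕ E → Finset E := fun x => Finset.univ.filter fun e =>
    e ∈ N.connective t ∧ e ∉ ρ ∧ (x = Sum.inr e ∨ N.Precedes x e) with hnb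
  have hmemnb : ∀ x e, e ∈ nb x ↔
      e ∈ N.connective t ∧ e ∉ ρ ∧ (x = Sum.inr e ∨ N.Precedes x e) := fun x e => by simp [hnb]
  obtain ⟨S₀, hS₀, σ, hinj, hσ⟩ := exists_matching_sdiff nb A B ⟨_, hmemA ⟨0, hw⟩⟩
    (by
      rw [Finset.disjoint_left]
      rintro (j | d) h1 h2
      · exact hmemB' _ h2
      · exact hmemA' _ h1)
    (by
      intro S hS hSA
      obtain ⟨x, hxS, hxA⟩ := Finset.not_disjoint_iff.mp hSA
      obtain ⟨j, rfl⟩ : ∃ j, x = Sum.inl j := by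
        rcases x with j | d
        · exact ⟨j, rfl⟩
        · exact absurd hxA (hmemA' d)
      set R : Finset E := Finset.univ.filter fun d => Sum.inr d ∈ S ∩ B with hR
      have hmemR : ∀ d, d ∈ R ↔ Sum.inr d ∈ S ∩ B := fun d => by simp [hR]
      have hcard : S ∩ B = R.map Function.Embedding.inr := by
        ext (j | d)
        · simp [hmemB']
        · simp only [Finset.mem_map, hmemR]
          simp
      have hAc : A.card = w := by simp [hA]
      set C : Finset E := Finset.univ.filter fun e => e ∈ N.connective t ∧ e ∉ R ∧
        (N.tail e = N.source ∨ ∃ d ∈ R, N.Adj d e) with hC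
      have hCc : N.minCut N.source t ≤ C.card := by
        refine minCut_le_card_boundary (R := R) ?_ ?_
        · intro e he
          exact ((hmemB e).mp (Finset.mem_inter.mp ((hmemR e).mp he)).2).2
        · intro e h1 h2 h3
          simp [hC, h1, h2, h3]
      have hsub : (R ∪ C) \ ρ ⊆ S.biUnion nb := by
        intro e he
        obtain ⟨h1, h2⟩ := Finset.mem_sdiff.mp he
        rw [Finset.mem_biUnion]
        rcases Finset.mem_union.mp h1 with h1 | h1
        · have h3 := Finset.mem_inter.mp ((hmemR e).mp h1)
          exact ⟨_, h3.1, (hmemnb _ _).mpr ⟨((hmemB e).mp h3.2).1, h2, Or.inl rfl⟩⟩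
        · obtain ⟨-, h3, h4, h5⟩ := Finset.mem_filter.mp h1
          rcases h5 with h5 | ⟨d, hd, hde⟩
          · exact ⟨_, hxS, (hmemnb _ _).mpr ⟨h3, h2, Or.inr h5⟩⟩
          · exact ⟨_, (Finset.mem_inter.mp ((hmemR d).mp hd)).1,
              (hmemnb _ _).mpr ⟨h3, h2, Or.inr hde⟩⟩
      have hRC : Disjoint R C := by
        rw [Finset.disjoint_left]
        intro e he heC
        exact (Finset.mem_filter.mp heC).2.2.1 he
      have h6 := Finset.card_le_card hsub
      have h7 := Finset.le_card_sdiff ρ (R ∪ C)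
      rw [Finset.card_union_of_disjoint hRC] at h7
      rw [hcard, Finset.card_map, hAc]
      omega)
  have hnbσ : ∀ x ∈ (A ∪ B) \ S₀, σ x ∈ N.connective t ∧ σ x ∉ ρ ∧
      (x = Sum.inr (σ x) ∨ N.Precedes x (σ x)) := fun x hx =>
    (hmemnb _ _).mp (Finset.mem_sdiff.mp (hσ x hx)).1
  refine ⟨(A ∪ B) \ S₀, σ, hinj, fun x hx => (hnbσ x hx).2.2, fun j => ?_, fun d hd => ?_,
    fun x hx => (hnbσ x hx).1, fun x hx => (hnbσ x hx).2.1, fun x hx d hd hdx => ?_⟩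
  · exact Finset.mem_sdiff.mpr ⟨Finset.mem_union_left _ (hmemA j), fun h => hmemB' j (hS₀ h)⟩
  · have h1 := (Finset.mem_union.mp (Finset.mem_sdiff.mp hd).1).resolve_left (hmemA' d)
    exact ((hmemB d).mp h1).2
  · obtain ⟨h1, h2, -⟩ := hnbσ x hx
    have h3 := (Finset.mem_sdiff.mp (hσ x hx)).2
    refine Finset.mem_sdiff.mpr ⟨Finset.mem_union_right _ ((hmemB d).mpr ⟨?_, hd⟩), fun h => ?_⟩
    · rcases hdx with rfl | hdx
      · exact h1
      · exact mem_connective_of_adj hdx h1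
    -- An unknown of `S₀` occurring in the equation `σ x` would have caused that equation to be
    -- deleted along with `S₀`.
    · refine h3 (Finset.mem_biUnion.mpr ⟨_, h, (hmemnb _ _).mpr ⟨h1, h2, ?_⟩⟩)
      rcases hdx with rfl | hdx
      · exact Or.inl rfl
      · exact Or.inr hdx

/-! ### Transfer equations of a linear network code -/

theorem LinearCode.sum_coeff_mul [Fintype E] [DecidableEq V] {w : ℕ} {F : Type*} [Field F]
    (c : N.LinearCode w F) (e : E) (f : E → F) :
    ∑ d : {d : E // N.Adj d e}, c.coeff d e * f d = ∑ d, c.coeff d e * f d := by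
  rw [← Finset.sum_subtype (Finset.univ.filter fun d => N.Adj d e) (by simp)
    (fun d => c.coeff d e * f d)]
  refine Finset.sum_subset (Finset.filter_subset _ _) fun d _ hd => ?_
  rw [c.coeff_eq_zero d e (by simpa using hd), zero_mul]

section Code

variable [Fintype E] [DecidableEq V] [DecidableEq E] {w : ℕ} {F : Type*} [Field F]

namespace LinearCode

theorem extKernel_inl (c : N.LinearCode w F) (e : E) (j : Fin w) :
    c.extKernel e (Sum.inl j) =
      c.srcCoeff j e + ∑ d, c.coeff d e * c.extKernel d (Sum.inl j) := by
  conv_lhs => rw [extKernel_eq]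
  simp [Finset.sum_apply, Pi.single_apply,
    sum_coeff_mul c e fun d => c.extKernel d (Sum.inl j)]

theorem extKernel_inr (c : N.LinearCode w F) (e d' : E) :
    c.extKernel e (Sum.inr d') =
      ∑ d, c.coeff d e * c.extKernel d (Sum.inr d') + if d' = e then 1 else 0 := by
  conv_lhs => rw [extKernel_eq]
  simp [Finset.sum_apply, Pi.single_apply,
    sum_coeff_mul c e fun d => c.extKernel d (Sum.inr d')]

/-- The symbols carried by the channels when the input is `Y`. -/
noncomputable def output (c : N.LinearCode w F) (Y : Fin w ⊕ E → F) (e : E) : F :=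
  ∑ x, Y x * c.extKernel e x

theorem vecMul_decodingMatrix (c : N.LinearCode w F) (Y : Fin w ⊕ E → F) (t : V)
    (e : {e : E // N.head e = t}) :
    Matrix.vecMul Y (c.decodingMatrix t) e = c.output Y e := rfl

theorem output_eq (c : N.LinearCode w F) (Y : Fin w ⊕ E → F) (e : E) :
    c.output Y e = ∑ j, Y (Sum.inl j) * c.srcCoeff j e + ∑ d, c.coeff d e * c.output Y d
      + Y (Sum.inr e) := by
  have h : ∑ d, c.coeff d e * c.output Y d =
      ∑ j, Y (Sum.inl j) * ∑ d, c.coeff d e * c.extKernel d (Sum.inl j) +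
      ∑ d', Y (Sum.inr d') * ∑ d, c.coeff d e * c.extKernel d (Sum.inr d') := by
    simp only [output, Fintype.sum_sum_type, mul_add, Finset.mul_sum, Finset.sum_add_distrib]
    congr 1
    · rw [Finset.sum_comm]
      exact Finset.sum_congr rfl fun _ _ => Finset.sum_congr rfl fun _ _ => by ring
    · rw [Finset.sum_comm]
      exact Finset.sum_congr rfl fun _ _ => Finset.sum_congr rfl fun _ _ => by ring
  rw [h]
  simp only [output, Fintype.sum_sum_type]
  simp_rw [extKernel_inl c e, extKernel_inr c e, mul_add, Finset.sum_add_distrib]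
  simp
  ring

/-- The matrix of all extended global encoding kernels, restricted to the rows in `E`. -/
noncomputable def transferMatrix (c : N.LinearCode w F) : Matrix E E F :=
  Matrix.of fun d e => c.extKernel e (Sum.inr d)

theorem transferMatrix_mul_sub (c : N.LinearCode w F) :
    c.transferMatrix * (1 - Matrix.of c.coeff) = 1 := by
  ext d' e
  rw [mul_sub, mul_one, Matrix.sub_apply, Matrix.mul_apply, Matrix.one_apply]
  simp only [transferMatrix, Matrix.of_apply]
  rw [extKernel_inr c e]
  simp_rw [mul_comm (c.extKernel _ _)]
  ring

theorem sub_mul_transferMatrix (c : N.LinearCode w F) :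
    (1 - Matrix.of c.coeff) * c.transferMatrix = 1 :=
  mul_eq_one_comm.mp c.transferMatrix_mul_sub

/-- The defining recursion runs over predecessors of `e`. Since a one-sided inverse of a square
matrix is two-sided, it also runs over successors of `d`, which lets an error be pushed downstream.
-/
theorem extKernel_inr_eq_sum (c : N.LinearCode w F) (e d : E) :
    c.extKernel e (Sum.inr d) =
      (if d = e then 1 else 0) + ∑ d', c.coeff d d' * c.extKernel e (Sum.inr d') := by
  have h := congrFun (congrFun c.sub_mul_transferMatrix d) e
  rw [sub_mul, one_mul, Matrix.sub_apply, Matrix.mul_apply, Matrix.one_apply] at h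
  simp only [transferMatrix, Matrix.of_apply] at h
  linear_combination h

theorem extKernel_inl_eq_sum (c : N.LinearCode w F) (e : E) (j : Fin w) :
    c.extKernel e (Sum.inl j) = ∑ d, c.srcCoeff j d * c.extKernel e (Sum.inr d) := by
  have h1 : Matrix.vecMul (fun e => c.extKernel e (Sum.inl j)) (1 - Matrix.of c.coeff) =
      c.srcCoeff j := by
    ext e
    rw [Matrix.vecMul_sub, Matrix.vecMul_one, Pi.sub_apply, extKernel_inl]
    simp [Matrix.vecMul, dotProduct, mul_comm]
  have h2 := congrArg (fun v => Matrix.vecMul v c.transferMatrix) h1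
  simp only [Matrix.vecMul_vecMul] at h2
  rw [c.sub_mul_transferMatrix, Matrix.vecMul_one] at h2
  exact congrFun h2 e

/-! ### Message and error spaces -/

theorem mem_messageSpace {c : N.LinearCode w F} {t : V} {y : {e : E // N.head e = t} → F} :
    y ∈ c.messageSpace t ↔
      ∃ X : Fin w → F, y = Matrix.vecMul (Sum.elim X 0) (c.decodingMatrix t) := Iff.rfl

/-- The row of the decoding matrix that belongs to an error on `d`. -/
theorem row_mem_errorSpace (c : N.LinearCode w F) (t : V) {ρ : Finset E} {d : E} (hd : d ∈ ρ) :
    (fun e : {e : E // N.head e = t} => c.extKernel e (Sum.inr d)) ∈ c.errorSpace t ρ := by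
  refine ⟨Pi.single d 1, fun e he => ?_, ?_⟩
  · have : e ≠ d := by rintro rfl; exact he hd
    simp [this]
  · ext e
    rw [vecMul_decodingMatrix, output, Fintype.sum_sum_type]
    simp [Pi.single_apply]

/-- Induction from downstream: outside `C`, the row of `d` is a combination of the rows of its
successors, from which every path to `t` still meets `C`. -/
theorem row_mem_errorSpace_of_isCut (c : N.LinearCode w F) {t : V} {C : Finset E} (d : E)
    (h : ∀ p, N.IsPath (d :: p) (N.tail d) t → ∃ e ∈ d :: p, e ∈ C) :
    (fun e : {e : E // N.head e = t} => c.extKernel e (Sum.inr d)) ∈ c.errorSpace t C := by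
  have hwf : WellFounded fun d e => N.Adj e d := by
    have : Std.Irrefl (Relation.TransGen (fun d e => N.Adj e d)) := ⟨fun a ha =>
      N.acyclic a (Relation.transGen_swap.mp ha)⟩
    exact Subrelation.wf (r := Relation.TransGen fun d e => N.Adj e d)
      (fun hab => Relation.TransGen.single hab)
        (Finite.wellFounded_of_trans_of_irrefl (Relation.TransGen fun d e => N.Adj e d))
  induction d using hwf.induction with
  | _ d ih =>
    by_cases hd : d ∈ C
    · exact row_mem_errorSpace c t hd
    have hne : N.head d ≠ t := by
      rintro rfl
      obtain ⟨e, he, heC⟩ := h [] (isPath_singleton d)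
      rw [List.mem_singleton.mp he] at heC
      exact hd heC
    have hrow : (fun e : {e : E // N.head e = t} => c.extKernel e (Sum.inr d)) =
        ∑ d', c.coeff d d' •
          fun e : {e : E // N.head e = t} => c.extKernel e (Sum.inr d') := by
      ext e
      have : d ≠ e := by rintro rfl; exact hne e.2
      rw [extKernel_inr_eq_sum]
      simp [this]
    rw [hrow]
    refine Submodule.sum_mem _ fun d' _ => ?_
    by_cases hadj : N.Adj d d'
    · refine Submodule.smul_mem _ _ (ih d' hadj fun p hp => ?_)
      obtain ⟨e, he, heC⟩ := h (d' :: p) (isPath_cons_iff.mpr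
        ⟨rfl, Or.inr (by rwa [show N.head d = N.tail d' from hadj])⟩)
      rcases List.mem_cons.mp he with rfl | he
      · exact absurd heC hd
      · exact ⟨e, he, heC⟩
    · rw [c.coeff_eq_zero d d' hadj, zero_smul]
      exact Submodule.zero_mem _

theorem messageSpace_le_errorSpace (c : N.LinearCode w F) {t : V} {C : Finset E}
    (hC : N.IsCut C N.source t) : c.messageSpace t ≤ c.errorSpace t C := by
  rintro y ⟨X, rfl⟩
  have hrow : Matrix.vecMul (Sum.elim X 0) (c.decodingMatrix t) =
      ∑ j, X j • ∑ d, c.srcCoeff j d •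
        fun e : {e : E // N.head e = t} => c.extKernel e (Sum.inr d) := by
    ext e
    rw [vecMul_decodingMatrix, output, Fintype.sum_sum_type]
    simp_rw [extKernel_inl_eq_sum c e]
    simp [Finset.sum_apply]
  rw [hrow]
  refine Submodule.sum_mem _ fun j _ => Submodule.smul_mem _ _ <|
    Submodule.sum_mem _ fun d _ => ?_
  by_cases hd : N.tail d = N.source
  · exact Submodule.smul_mem _ _ (row_mem_errorSpace_of_isCut c d fun p hp => hC _ (hd ▸ hp))
  · rw [c.srcCoeff_eq_zero j d hd, zero_smul]
    exact Submodule.zero_mem _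

/-! ### Error resistance and minimum distance -/

/-- The code recovers the message at `t` from errors on any `n` channels: an input with at
most `n` errors and zero output at `t` has zero message. -/
def Resists (c : N.LinearCode w F) (t : V) (n : ℕ) : Prop :=
  ∀ (X : Fin w → F) (Z : E → F) (ρ : Finset E), ρ.card ≤ n → (∀ e ∉ ρ, Z e = 0) →
    Matrix.vecMul (Sum.elim X Z) (c.decodingMatrix t) = 0 → X = 0

theorem Resists.finrank_messageSpace {c : N.LinearCode w F} {t : V} {n : ℕ}
    (h : c.Resists t n) : Module.finrank F (c.messageSpace t) = w := by
  set L : (Fin w → F) →ₗ[F] ({e : E // N.head e = t} → F) :=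
    { toFun := fun X => Matrix.vecMul (Sum.elim X 0) (c.decodingMatrix t)
      map_add' := fun X Y => by
        rw [← Matrix.add_vecMul, ← Sum.elim_add_add, add_zero]
      map_smul' := fun a X => by
        rw [RingHom.id_apply, ← Matrix.smul_vecMul]
        congr 1
        ext (i | i) <;> simp } with hL
  have hinj : Function.Injective L := by
    rw [injective_iff_map_eq_zero]
    exact fun X hX => h X 0 ∅ (by simp) (by simp) hX
  have hr : c.messageSpace t = LinearMap.range L := by
    ext y
    rw [mem_messageSpace, LinearMap.mem_range]
    exact exists_congr fun X => eq_comm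
  rw [hr, LinearMap.finrank_range_of_inj hinj, Module.finrank_fin_fun]

theorem Resists.errorSpace_inf_messageSpace {c : N.LinearCode w F} {t : V} {n : ℕ}
    (h : c.Resists t n) {ρ : Finset E} (hρ : ρ.card ≤ n) :
    c.errorSpace t ρ ⊓ c.messageSpace t = ⊥ := by
  rw [eq_bot_iff]
  rintro y ⟨⟨Z, hZ, hy⟩, ⟨X, hX⟩⟩
  have h0 : X = 0 := by
    refine h X (-Z) ρ hρ (fun e he => by simp [hZ e he]) ?_
    have h1 : (Sum.elim X (-Z) : Fin w ⊕ E → F) =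
        Sum.elim X 0 - Sum.elim (0 : Fin w → F) Z := by
      ext (i | i) <;> simp
    rw [h1, Matrix.sub_vecMul, ← hX, ← hy, sub_self]
  have h2 : (Sum.elim (0 : Fin w → F) 0 : Fin w ⊕ E → F) = 0 := by ext (i | i) <;> rfl
  rw [Submodule.mem_bot, hX, h0, h2, Matrix.zero_vecMul]

theorem Resists.isMinDist {c : N.LinearCode w F} {t : V} (hw : 1 ≤ w)
    (hwC : w ≤ N.minCut N.source t) (h : c.Resists t (N.redundancy w t)) :
    c.IsMinDist t (N.redundancy w t + 1) := by
  have hlow : ∀ ρ : Finset E,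
      0 < Module.finrank F (c.errorSpace t ρ ⊓ c.messageSpace t : Submodule F _) →
        N.redundancy w t + 1 ≤ N.patternRank w F t ρ := by
    intro ρ hρ
    obtain ⟨ρ', hdom, hcard⟩ :=
      Nat.sInf_mem (s := {n | ∃ ρ' : Finset E, N.Dominated w F t ρ ρ' ∧ ρ'.card = n})
        ⟨_, ρ, fun c => le_rfl, rfl⟩
    by_contra! hlt
    have h1 := h.errorSpace_inf_messageSpace (ρ := ρ')
      (by rw [hcard]; exact Nat.lt_succ_iff.mp hlt)
    have h2 : c.errorSpace t ρ ⊓ c.messageSpace t = ⊥ :=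
      le_bot_iff.mp (h1 ▸ inf_le_inf_right _ (hdom c))
    rw [h2, finrank_bot] at hρ
    exact lt_irrefl _ hρ
  refine ⟨?_, fun n ⟨ρ, hρ, hn⟩ => hn ▸ hlow ρ hρ⟩
  obtain ⟨C, hC, hCc⟩ := exists_isCut_card_eq_minCut (N := N) N.source t
  have hunit : ∀ j : Fin w, ∃ Z : E → F, (∀ e ∉ C, Z e = 0) ∧
      Matrix.vecMul (Sum.elim (Pi.single j 1) 0) (c.decodingMatrix t) =
        Matrix.vecMul (Sum.elim 0 Z) (c.decodingMatrix t) := fun j =>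
    messageSpace_le_errorSpace c hC ⟨Pi.single j 1, rfl⟩
  choose Z hZ hZeq using hunit
  -- Messages have `w` coordinates, so `w - 1` channels of the cut can be made error-free by a
  -- nonzero message; `C_t - w + 1` channels remain.
  obtain ⟨C', hC'C, hC'c⟩ := Finset.exists_subset_card_eq (s := C) (n := w - 1) (by omega)
  obtain ⟨X, hXne, hX⟩ : ∃ X : Fin w → F, X ≠ 0 ∧ ∀ e ∈ C', ∑ j, X j * Z j e = 0 := by
    set L : (Fin w → F) →ₗ[F] (C' → F) := LinearMap.pi fun e =>
      ∑ j, Z j e • LinearMap.proj (R := F) (φ := fun _ : Fin w => F) j with hL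
    have hker : LinearMap.ker L ≠ ⊥ := by
      apply LinearMap.ker_ne_bot_of_finrank_lt
      simp [hC'c]
      omega
    obtain ⟨X, hX, hne⟩ := Submodule.exists_mem_ne_zero_of_ne_bot hker
    refine ⟨X, hne, fun e he => ?_⟩
    have := congrFun (LinearMap.mem_ker.mp hX) ⟨e, he⟩
    simpa [hL, mul_comm] using this
  set ρ := C \ C' with hρ
  have hρc : ρ.card = N.redundancy w t + 1 := by
    rw [hρ, Finset.card_sdiff_of_subset hC'C, hC'c, hCc, redundancy]
    omega
  have hpos : 0 < Module.finrank F (c.errorSpace t ρ ⊓ c.messageSpace t : Submodule F _) := by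
    rw [Module.finrank_pos_iff, Submodule.nontrivial_iff_ne_bot, Submodule.ne_bot_iff]
    refine ⟨Matrix.vecMul (Sum.elim X 0) (c.decodingMatrix t),
      ⟨⟨fun e => ∑ j, X j * Z j e, fun e he => ?_, ?_⟩, ⟨X, rfl⟩⟩, fun h0 => ?_⟩
    · by_cases heC : e ∈ C
      · exact hX e (by by_contra hn; exact he (Finset.mem_sdiff.mpr ⟨heC, hn⟩))
      · simp [hZ _ e heC]
    · have h1 : (Sum.elim X 0 : Fin w ⊕ E → F) =
          ∑ j, X j • Sum.elim (Pi.single j 1) 0 := by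
        ext (i | i) <;> simp [Finset.sum_apply, Pi.single_apply]
      have h2 : (Sum.elim 0 (fun e => ∑ j, X j * Z j e) : Fin w ⊕ E → F) =
          ∑ j, X j • Sum.elim (0 : Fin w → F) (Z j) := by
        ext (i | i) <;> simp [Finset.sum_apply]
      rw [h1, h2, Matrix.sum_vecMul, Matrix.sum_vecMul]
      exact Finset.sum_congr rfl fun j _ => by
        rw [Matrix.smul_vecMul, Matrix.smul_vecMul, hZeq]
    · exact hXne (h X 0 ∅ (by simp) (by simp) h0)
  refine ⟨ρ, hpos, le_antisymm ?_ (hlow ρ hpos)⟩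
  rw [← hρc]
  exact Nat.sInf_le ⟨ρ, fun c => le_rfl, rfl⟩

end LinearCode

/-! ### Construction of the code -/

/-- The linear network code with coefficients `κ`. -/
def codeOfCoeff (κ : E → Fin w ⊕ E → F) (hκ : ∀ e x, ¬ N.Precedes x e → κ e x = 0) :
    N.LinearCode w F where
  srcCoeff j e := κ e (Sum.inl j)
  coeff d e := κ e (Sum.inr d)
  srcCoeff_eq_zero j e h := hκ e (Sum.inl j) h
  coeff_eq_zero d e h := hκ e (Sum.inr d) h

theorem eq_zero_of_isLinkage {κ : E → Fin w ⊕ E → F}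
    {hκ : ∀ e x, ¬ N.Precedes x e → κ e x = 0} {t : V} {ρ : Finset E}
    {R : Finset (Fin w ⊕ E)} {σ : Fin w ⊕ E → E} (hR : N.IsLinkage t ρ R σ)
    (hinj : Function.Injective (stageMap κ R σ Finset.univ)) {X : Fin w → F} {Z : E → F}
    (hZ : ∀ e ∈ N.connective t, e ∉ ρ → Z e = 0)
    (h0 : Matrix.vecMul (Sum.elim X Z) ((codeOfCoeff κ hκ).decodingMatrix t) = 0) : X = 0 := by
  classical
  set c := codeOfCoeff κ hκ with hc
  set u := c.output (Sum.elim X Z) with hu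
  have hut : ∀ e, N.head e = t → u e = 0 := fun e he => congrFun h0 ⟨e, he⟩
  -- Truncation to `R` satisfies the unit rows outside `R`. By `hvR` the matched equations do not
  -- notice it.
  set v : Fin w ⊕ E → F := fun x => if x ∈ R then Sum.elim X u x else 0 with hv
  have hvR : ∀ x ∈ R, ∀ d, (d = σ x ∨ N.Adj d (σ x)) → v (Sum.inr d) = u d := by
    intro x hx d hd
    by_cases hdt : N.head d = t
    · simp [hv, hut d hdt]
    · simp [hv, hR.inr_mem x hx d hdt hd]
  have hv0 : v = 0 := by
    apply hinj
    rw [map_zero]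
    ext x
    by_cases hx : x ∈ R
    · rw [stageMap_of_mem hx (Finset.mem_univ _), Fintype.sum_sum_type, hvR x hx _ (Or.inl rfl)]
      have h1 : ∑ d, κ (σ x) (Sum.inr d) * v (Sum.inr d) = ∑ d, c.coeff d (σ x) * u d := by
        refine Finset.sum_congr rfl fun d _ => ?_
        by_cases hd : N.Adj d (σ x)
        · rw [hvR x hx d (Or.inr hd)]
          rfl
        · rw [hκ (σ x) (Sum.inr d) hd, c.coeff_eq_zero _ _ hd, zero_mul, zero_mul]
      have h2 := c.output_eq (Sum.elim X Z) (σ x)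
      simp only [Sum.elim_inl, Sum.elim_inr,
        hZ _ (hR.mem_connective x hx) (hR.notMem x hx), add_zero] at h2
      rw [h1, hu, h2]
      simp [hv, hR.inl_mem, hc, codeOfCoeff, mul_comm]
    · rw [stageMap_of_not (fun h => hx h.1)]
      simp [hv, hx]
  ext j
  have := congrFun hv0 (Sum.inl j)
  simpa [hv, hR.inl_mem] using this

theorem exists_isMDS (hw : 1 ≤ w) (hwC : ∀ t ∈ N.sinks, w ≤ N.minCut N.source t)
    (hF : ((∑ t ∈ N.sinks, (N.connective t).ncard.choose (N.redundancy w t) : ℕ) : ℕ∞) ≤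
      ENat.card F) : ∃ c : N.LinearCode w F, c.IsMDS := by
  classical
  set I : Finset (Σ _ : V, Finset E) := N.sinks.sigma fun t =>
    (N.connective t).toFinset.powersetCard (N.redundancy w t) with hI
  have hIc : I.card = ∑ t ∈ N.sinks, (N.connective t).ncard.choose (N.redundancy w t) := by
    rw [hI, Finset.card_sigma]
    exact Finset.sum_congr rfl fun t _ => by
      rw [Finset.card_powersetCard, Set.ncard_eq_toFinset_card']
  have hlink : ∀ i : I, ∃ (R : Finset (Fin w ⊕ E)) (σ : Fin w ⊕ E → E),
      N.IsLinkage i.1.1 i.1.2 R σ := by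
    intro i
    obtain ⟨h1, h2⟩ := Finset.mem_sigma.mp i.2
    apply exists_isLinkage hw
    rw [(Finset.mem_powersetCard.mp h2).2, redundancy]
    have := hwC _ h1
    omega
  choose R σ hRσ using hlink
  obtain ⟨κ, hκ, hinj⟩ := exists_coeff_stageMap_injective (F := F) (Pre := N.Precedes (w := w))
    N.adj_wf Finset.univ (by rw [Finset.card_univ, Fintype.card_coe, hIc]; exact hF) R σ
    (fun i _ => (hRσ i).injOn) (fun i _ => (hRσ i).precedes)
  have hres : ∀ t ∈ N.sinks, (codeOfCoeff κ hκ).Resists t (N.redundancy w t) := by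
    intro t ht X Z ρ hρ hZ h0
    -- Errors outside `E_t` enter none of the equations used, so `ρ` may be cut down to `E_t` and
    -- then enlarged there to exactly `δ_t` channels.
    have h1 : (ρ ∩ (N.connective t).toFinset).card ≤ N.redundancy w t :=
      (Finset.card_le_card Finset.inter_subset_left).trans hρ
    have h2 : N.redundancy w t ≤ (N.connective t).toFinset.card := by
      rw [← Set.ncard_eq_toFinset_card']
      exact (Nat.sub_le _ _).trans (minCut_le_ncard_connective t)
    obtain ⟨ρ', hρ', hρ'E, hρ'c⟩ :=
      Finset.exists_subsuperset_card_eq Finset.inter_subset_right h1 h2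
    have hi : (⟨t, ρ'⟩ : Σ _ : V, Finset E) ∈ I :=
      Finset.mem_sigma.mpr ⟨ht, Finset.mem_powersetCard.mpr ⟨hρ'E, hρ'c⟩⟩
    refine eq_zero_of_isLinkage (hRσ ⟨_, hi⟩) (hinj _ (Finset.mem_univ _))
      (fun e he heρ => hZ e fun h => heρ ?_) h0
    exact hρ' (Finset.mem_inter.mpr ⟨h, Set.mem_toFinset.mpr he⟩)
  exact ⟨codeOfCoeff κ hκ, fun t ht => (hres t ht).finrank_messageSpace,
    fun t ht => (hres t ht).isMinDist hw (hwC t ht)⟩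

end Code

/-! ### Comparison of the two binomial sums -/

theorem ncard_connective_le [Fintype E] (t : V) :
    (N.connective t).ncard ≤ Fintype.card E := by
  rw [← Nat.card_eq_fintype_card]
  exact Set.ncard_le_card _

/-- A positive minimum cut forces a channel into `t'`; it leads nowhere else, because sinks have no
outgoing channels. -/
theorem ncard_connective_lt [Fintype E] {t t' : V} (ht' : t' ∈ N.sinks) (hne : t' ≠ t)
    (h : 0 < N.minCut N.source t') : (N.connective t).ncard < Fintype.card E := by
  obtain ⟨e, rfl⟩ := exists_head_eq h
  rw [← Nat.card_eq_fintype_card, ← Set.ncard_univ]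
  refine Set.ncard_lt_ncard ((Set.ssubset_univ_iff).mpr fun hu => ?_)
  exact notMem_connective_of_head_mem_sinks ht' hne (hu ▸ Set.mem_univ e)

end CommNetwork

theorem Nat.choose_lt_choose_of_lt {a b k : ℕ} (hk : 0 < k) (hka : k ≤ a) (hab : a < b) :
    a.choose k < b.choose k := by
  obtain ⟨k, rfl⟩ := Nat.exists_eq_succ_of_ne_zero hk.ne'
  refine lt_of_lt_of_le ?_ (Nat.choose_le_choose _ hab)
  rw [Nat.succ_eq_add_one, Nat.choose_succ_succ' a k]
  have := Nat.choose_pos (show k ≤ a by omega)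
  omega

theorem mainTheorem7 {V E : Type*} [Finite V] [Fintype E] [DecidableEq V] [DecidableEq E]
    (N : CommNetwork V E) (w : ℕ) (hw : 1 ≤ w) (hwC : ∀ t ∈ N.sinks, w ≤ N.minCut N.source t)
    (F : Type*) [Field F] :
    (((∑ t ∈ N.sinks, (N.connective t).ncard.choose (N.redundancy w t) : ℕ) : ℕ∞) ≤ ENat.card F →
      ∃ c : N.LinearCode w F, c.IsMDS) ∧
    (∑ t ∈ N.sinks, (N.connective t).ncard.choose (N.redundancy w t) ≤
      ∑ t ∈ N.sinks, (Fintype.card E).choose (N.redundancy w t)) ∧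
    (1 < N.sinks.card → (∃ t ∈ N.sinks, 0 < N.redundancy w t) →
      ∑ t ∈ N.sinks, (N.connective t).ncard.choose (N.redundancy w t) <
        ∑ t ∈ N.sinks, (Fintype.card E).choose (N.redundancy w t)) := by
  refine ⟨CommNetwork.exists_isMDS hw hwC, ?_, fun hT ⟨t, ht, hδ⟩ => ?_⟩
  · exact Finset.sum_le_sum fun t _ => Nat.choose_le_choose _ (N.ncard_connective_le t)
  · refine Finset.sum_lt_sum
      (fun t _ => Nat.choose_le_choose _ (N.ncard_connective_le t)) ⟨t, ht, ?_⟩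
    obtain ⟨t', ht', hne⟩ := Finset.exists_mem_ne hT t
    refine Nat.choose_lt_choose_of_lt hδ
      ((Nat.sub_le _ _).trans (CommNetwork.minCut_le_ncard_connective t)) ?_
    exact CommNetwork.ncard_connective_lt ht' hne (hw.trans (hwC t' ht'))
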